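/- Let $f\colon\mathbb{R}^d\to\mathbb{R}$ be a locally Lipschitz function that is Whitney $C^d$-stratifiable, in the sense below. Then the set of Clarke critical values of $f$, $$\{\, f(x) : x\in\mathbb{R}^d,\ 0\in\partial f(x)\,\},$$ has Lebesgue measure zero in $\mathbb{R}$. In particular, its complement, the set of noncritical values of $f$, is dense in $\mathbb{R}$ (the weak Sard property). Here $\partial f(x)=\mathrm{conv}\{\lim_{i\to\infty}\nabla f(x_i) : x_i\to x,\ f \text{ differentiable at each } x_i\}$ is the Clarke subdifferential. A set $M\subset\mathbb{R}^n$ is a $C^p$ manifold if there is an integer $0\le r\le n$ such that every $x\in M$ has an open neighborhood $U$ and a $C^p$ map $F\colon U\to\mathbb{R}^{n-r}$ with $\nabla F(x)$ of full rank $n-r$ and $M\cap U=\{y\in U: F(y)=0\}$; then $T_M(x)=\mathrm{Null}(\nabla F(x))$ and $N_M(x)=T_M(x)^\perp$. A Whitney $C^p$-stratification of a set $Q\subset\mathbb{R}^n$ is a partition of $Q$ into finitely many nonempty $C^p$ manifolds, called strata, such that 1. (frontier condition) for any two strata $L$ and $M$, if $L\cap\mathrm{cl}\,M\neq\emptyset$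 then $L\subset\mathrm{cl}\,M$; 2. (Whitney condition (a)) for any strata $L$ and $M$, if points $z_k\in M$ converge to a point $\bar z\in L$ and normal vectors $v_k\in N_M(z_k)$ converge to $v$, then $v\in N_L(\bar z)$. A function $f\colon\mathbb{R}^d\to\mathbb{R}$ is Whitney $C^p$-stratifiable if its graph, as a subset of $\mathbb{R}^d\times\mathbb{R}=\mathbb{R}^{d+1}$, admits a Whitney $C^p$-stratification. -/

import Mathlib

open Filter Topology MeasureTheory

section Manifolds

variable {E : Type*} [NormedAddCommGroup E] [InnerProductSpace ℝ E]

/-- `F` is a `C^p` map on the open neighborhood `U` of `x`, its derivative at `x` has full rank,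
and `M ∩ U` is the zero set of `F` in `U`. -/
structure IsLocalDefiningMap (p : WithTop ℕ∞) (M : Set E) (x : E) (U : Set E) {m : ℕ}
    (F : E → EuclideanSpace ℝ (Fin m)) : Prop where
  isOpen : IsOpen U
  mem : x ∈ U
  contDiffOn : ContDiffOn ℝ p F U
  surjective : Function.Surjective (fderiv ℝ F x)
  inter_eq : M ∩ U = {y ∈ U | F y = 0}

/-- `M` is a `C^p` submanifold of `E`, of some dimension `r` and codimension `m`. -/
def IsCpManifold (p : WithTop ℕ∞) (M : Set E) : Prop :=
  ∃ r m : ℕ, r + m = Module.finrank ℝ E ∧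
    ∀ x ∈ M, ∃ (U : Set E) (F : E → EuclideanSpace ℝ (Fin m)), IsLocalDefiningMap p M x U F

/-- The tangent space to `M` at `x`: the null space of the derivative at `x` of a local defining
map. For a `C^p` manifold, `p ≥ 1`, and `x ∈ M`, it does not depend on the defining map, so the
span is taken of a set that is already a linear subspace. -/
noncomputable def tangentSpaceAt (p : WithTop ℕ∞) (M : Set E) (x : E) : Submodule ℝ E :=
  Submodule.span ℝ {w | ∃ (m : ℕ) (U : Set E) (F : E → EuclideanSpace ℝ (Fin m)),
    IsLocalDefiningMap p M x U F ∧ fderiv ℝ F x w = 0}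

/-- The normal space to `M` at `x`. -/
noncomputable def normalSpaceAt (p : WithTop ℕ∞) (M : Set E) (x : E) : Submodule ℝ E :=
  (tangentSpaceAt p M x)ᗮ

/-- `𝒜` is a Whitney `C^p`-stratification of the set `Q`. -/
structure IsWhitneyStratification (p : WithTop ℕ∞) (𝒜 : Set (Set E)) (Q : Set E) : Prop where
  finite : 𝒜.Finite
  nonempty : ∀ M ∈ 𝒜, M.Nonempty
  pairwiseDisjoint : 𝒜.PairwiseDisjoint id
  sUnion_eq : ⋃₀ 𝒜 = Q
  isCpManifold : ∀ M ∈ 𝒜, IsCpManifold p M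
  frontier_condition : ∀ L ∈ 𝒜, ∀ M ∈ 𝒜, (L ∩ closure M).Nonempty → L ⊆ closure M
  whitney_condition_a : ∀ L ∈ 𝒜, ∀ M ∈ 𝒜, ∀ (z v : ℕ → E) (z₀ v₀ : E),
    (∀ k, z k ∈ M) → z₀ ∈ L → Tendsto z atTop (𝓝 z₀) →
    (∀ k, v k ∈ normalSpaceAt p M (z k)) → Tendsto v atTop (𝓝 v₀) →
    v₀ ∈ normalSpaceAt p L z₀

end Manifolds

section Functions

variable {d : ℕ}

/-- The graph of `f`, in `ℝ^d × ℝ` with its Euclidean structure. -/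
def euclideanGraph (f : EuclideanSpace ℝ (Fin d) → ℝ) :
    Set (WithLp 2 (EuclideanSpace ℝ (Fin d) × ℝ)) :=
  {z | f z.fst = z.snd}

/-- `f` is Whitney `C^p`-stratifiable. -/
def IsWhitneyStratifiable (p : WithTop ℕ∞) (f : EuclideanSpace ℝ (Fin d) → ℝ) : Prop :=
  ∃ 𝒜 : Set (Set (WithLp 2 (EuclideanSpace ℝ (Fin d) × ℝ))),
    IsWhitneyStratification p 𝒜 (euclideanGraph f)

/-- The Clarke subdifferential of `f` at `x`: the convex hull of the limits of gradients along
sequences of points of differentiability that converge to `x`. -/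
def clarkeSubdifferential (f : EuclideanSpace ℝ (Fin d) → ℝ) (x : EuclideanSpace ℝ (Fin d)) :
    Set (EuclideanSpace ℝ (Fin d)) :=
  convexHull ℝ {v | ∃ u : ℕ → EuclideanSpace ℝ (Fin d),
    (∀ i, DifferentiableAt ℝ f (u i)) ∧ Tendsto u atTop (𝓝 x) ∧
    Tendsto (fun i => gradient f (u i)) atTop (𝓝 v)}

/-- `x` is a Clarke critical point of `f`. -/
def IsClarkeCritical (f : EuclideanSpace ℝ (Fin d) → ℝ) (x : EuclideanSpace ℝ (Fin d)) : Prop :=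
  0 ∈ clarkeSubdifferential f x

/-- The set of Clarke critical values of `f`. -/
def clarkeCriticalValues (f : EuclideanSpace ℝ (Fin d) → ℝ) : Set ℝ :=
  {r | ∃ x, IsClarkeCritical f x ∧ f x = r}

end Functions

/-! A Clarke critical point of `f` is an ordinary critical point of the height `(x, r) ↦ r` on a
stratum of the graph. Where `f` is differentiable, `(-∇f(u), 1)` is normal to the stratum through
`(u, f u)`. Whitney's condition (a) passes this to limits of gradients, and convexity to the whole
Clarke subdifferential (`mem_normalSpaceAt_of_mem_clarkeSubdifferential`). Thus `0 ∈ ∂f(x)` makes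
`(0, 1)` normal to the stratum through `(x, f x)`: the height has zero derivative along it. Strata
are `C^d` of dimension at most `d`, so Morse-Sard (`volume_image_setOf_fderiv_eq_zero`), applied in
countably many local parametrizations, shows that these heights form a null set.

Morse-Sard rests on Morse's lemma (`isFlatCovered_self`). Applied to the derivative of a `C^(k+1)`
function on its critical set, it gives countably many pieces where the derivative is `o(dist^k)`.
Increments of the function are then `o(dist^(k+1))`, so images are null when the dimension is at
most `k + 1`. -/

open Set Metric
open scoped ENNReal NNReal

/-! ### Local parametrization of level sets -/

/-- A level set of a `C^p` map with surjective derivative is locally contained in the range of a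
globally defined `C^p` map from a Euclidean space, which takes values in the level set. -/
theorem exists_contDiff_parametrization {E F : Type*} [NormedAddCommGroup E] [NormedSpace ℝ E]
    [FiniteDimensional ℝ E] [NormedAddCommGroup F] [NormedSpace ℝ F] [FiniteDimensional ℝ F]
    {p : ℕ} (hp : p ≠ 0) {g : E → F} {x : E} (hg : ContDiffAt ℝ p g x)
    (hsurj : Function.Surjective (fderiv ℝ g x)) {r : ℕ}
    (hr : r + Module.finrank ℝ F = Module.finrank ℝ E) {U : Set E} (hU : U ∈ 𝓝 x) :
    ∃ φ : EuclideanSpace ℝ (Fin r) → E, ContDiff ℝ p φ ∧ (∀ t, φ t ∈ U ∧ g (φ t) = g x) ∧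
      ∀ᶠ y in 𝓝 x, g y = g x → y ∈ range φ := by
  have hp' : (p : WithTop ℕ∞) ≠ 0 := by exact_mod_cast hp
  have := FiniteDimensional.complete ℝ E
  have := FiniteDimensional.complete ℝ F
  have hrange : (fderiv ℝ g x).range = ⊤ := LinearMap.range_eq_top.2 hsurj
  let Φ := HasStrictFDerivAt.implicitFunctionDataOfComplemented g (fderiv ℝ g x)
    (hg.hasStrictFDerivAt hp') hrange (fderiv ℝ g x).ker_closedComplemented_of_finiteDimensional_range
  have hleft : Φ.leftFun = g := rfl
  have hpt : Φ.pt = x := rfl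
  have hright : ContDiff ℝ p Φ.rightFun := by
    change ContDiff ℝ p fun y => (_ : E →L[ℝ] (fderiv ℝ g x).ker) (y - x)
    fun_prop
  have hright0 : Φ.rightFun x = 0 := by
    change (_ : E →L[ℝ] (fderiv ℝ g x).ker) (x - x) = 0
    rw [sub_self, map_zero]
  have hprod : Φ.prodFun Φ.pt = (g x, 0) := by
    rw [Φ.prodFun_apply, hpt, hright0, hleft]
  have hsmooth := Φ.contDiffAt_implicitFunction (n := p) hg hright.contDiffAt hp'
  rw [hprod] at hsmooth
  have hdim : Module.finrank ℝ (EuclideanSpace ℝ (Fin r)) =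
      Module.finrank ℝ (fderiv ℝ g x).ker := by
    have h1 := (fderiv ℝ g x).toLinearMap.finrank_range_add_finrank_ker
    have h2 : Module.finrank ℝ (fderiv ℝ g x).range = Module.finrank ℝ F := by
      rw [hrange, finrank_top]
    simp only [finrank_euclideanSpace, Fintype.card_fin]
    change Module.finrank ℝ (fderiv ℝ g x).range + Module.finrank ℝ (fderiv ℝ g x).ker = _ at h1
    omega
  let e : EuclideanSpace ℝ (Fin r) ≃L[ℝ] (fderiv ℝ g x).ker :=
    ContinuousLinearEquiv.ofFinrankEq hdim
  let ψ : EuclideanSpace ℝ (Fin r) → E := fun t => Φ.implicitFunction (g x) (e t)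
  have hpair : ContDiff ℝ p fun t : EuclideanSpace ℝ (Fin r) => (g x, e t) :=
    contDiff_const.prodMk e.contDiff
  have hψ : ContDiffAt ℝ p ψ 0 := by
    refine ContDiffAt.comp (g := Φ.implicitFunction.uncurry) 0 ?_ hpair.contDiffAt
    simpa using hsmooth
  have hψ0 : ψ 0 = x := by
    have h := Φ.implicitFunction_apply_image.self_of_nhds
    rw [hpt, hright0, hleft] at h
    simpa [ψ] using h
  have hψU : ∀ᶠ t in 𝓝 0, ψ t ∈ U :=
    hψ.continuousAt.eventually_mem (by rwa [hψ0])
  have hψg : ∀ᶠ t in 𝓝 0, g (ψ t) = g x := by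
    have h := Φ.leftFun_implicitFunction
    rw [hprod] at h
    have ht : Tendsto (fun t => (g x, e t)) (𝓝 0) (𝓝 (g x, 0)) := by
      simpa using hpair.continuous.tendsto 0
    exact ht.eventually h
  obtain ⟨δ, hδ, hball⟩ := Metric.eventually_nhds_iff_ball.1
    ((hψ.eventually (by simp)).and (hψU.and hψg))
  -- Precomposing with `ρ`, which is the identity on the half ball and maps everything into the
  -- `δ`-ball, turns the local parametrization into a global map.
  let χ : ContDiffBump (0 : EuclideanSpace ℝ (Fin r)) := ⟨δ / 2, δ, by positivity, by linarith⟩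
  let ρ : EuclideanSpace ℝ (Fin r) → EuclideanSpace ℝ (Fin r) := fun t => χ t • t
  have hρ : ContDiff ℝ p ρ := χ.contDiff.smul contDiff_id
  have hρball : ∀ t, ρ t ∈ ball (0 : EuclideanSpace ℝ (Fin r)) δ := by
    intro t
    by_cases ht : t ∈ ball (0 : EuclideanSpace ℝ (Fin r)) δ
    · rw [mem_ball_zero_iff] at ht ⊢
      refine lt_of_le_of_lt ?_ ht
      rw [norm_smul, Real.norm_of_nonneg χ.nonneg]
      exact mul_le_of_le_one_left (norm_nonneg _) χ.le_one
    · have h0 : χ t = 0 := χ.zero_of_le_dist (by simpa using ht)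
      simp [ρ, h0, hδ]
  refine ⟨ψ ∘ ρ, ?_, fun t => (hball _ (hρball t)).2, ?_⟩
  · exact contDiff_iff_contDiffAt.2 fun t =>
      (hball _ (hρball t)).1.comp t hρ.contDiffAt
  · have hsmall : ∀ᶠ y in 𝓝 x, e.symm (Φ.rightFun y) ∈
        ball (0 : EuclideanSpace ℝ (Fin r)) (δ / 2) := by
      have hc : ContinuousAt (fun y => e.symm (Φ.rightFun y)) x :=
        (e.symm.continuous.comp hright.continuous).continuousAt
      refine hc.eventually_mem ?_
      rw [hright0, map_zero]
      exact ball_mem_nhds _ (by positivity)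
    have h := Φ.implicitFunction_apply_image
    rw [hpt, hleft] at h
    filter_upwards [hsmall, h] with y hy1 hy2 hy3
    refine ⟨e.symm (Φ.rightFun y), ?_⟩
    have h1 : χ (e.symm (Φ.rightFun y)) = 1 := χ.one_of_mem_closedBall (ball_subset_closedBall hy1)
    simp only [Function.comp, ρ, h1, one_smul, ψ, e.apply_symm_apply]
    rw [← hy3, hy2]

/-! ### Flat pieces and Morse's lemma -/

/-- Integrating a flatness bound on the derivative along segments. -/
theorem norm_comp_sub_le_of_fderiv_flat {E G F : Type*} [NormedAddCommGroup E] [NormedSpace ℝ E]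
    [ProperSpace E] [NormedAddCommGroup G] [NormedSpace ℝ G] [NormedAddCommGroup F]
    [NormedSpace ℝ F] {k : ℕ} {ψ : E → G} (hψ : ContDiff ℝ 1 ψ) {f : G → F}
    (hf : Differentiable ℝ f) {R : ℝ} {S : Set E} (hS : S ⊆ closedBall 0 R)
    (hflat : ∀ ε > 0, ∃ δ > 0, ∀ x ∈ S, ∀ y ∈ closedBall (0 : E) R, dist x y < δ →
      ‖fderiv ℝ f (ψ y)‖ ≤ ε * dist x y ^ k) :
    ∀ ε > 0, ∃ δ > 0, ∀ x ∈ S, ∀ y ∈ closedBall (0 : E) R, dist x y < δ →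
      ‖f (ψ y) - f (ψ x)‖ ≤ ε * dist x y ^ (k + 1) := by
  intro ε hε
  obtain ⟨C, hC⟩ := (isCompact_closedBall (0 : E) R).exists_bound_of_continuousOn
    (hψ.continuous_fderiv (by simp)).continuousOn
  have hC' : 0 < max C 1 := lt_max_of_lt_right one_pos
  obtain ⟨δ, hδ, h⟩ := hflat (ε / max C 1) (by positivity)
  refine ⟨δ, hδ, fun x hx y hy hxy => ?_⟩
  -- On this intersection `fderiv ℝ ψ` is bounded and no point is farther from `x` than `y` is, so
  -- one flatness bound serves the whole segment.
  have hconv : Convex ℝ (closedBall (0 : E) R ∩ closedBall x (dist x y)) :=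
    (convex_closedBall _ _).inter (convex_closedBall _ _)
  have key : ‖(f ∘ ψ) y - (f ∘ ψ) x‖ ≤ ε * dist x y ^ k * ‖y - x‖ := by
    refine hconv.norm_image_sub_le_of_norm_hasFDerivWithin_le
      (f' := fun z => (fderiv ℝ f (ψ z)).comp (fderiv ℝ ψ z)) (fun z _ => ?_) (fun z hz => ?_)
      ⟨hS hx, mem_closedBall_self dist_nonneg⟩ ⟨hy, by simp [dist_comm]⟩
    · exact ((hf _).hasFDerivAt.comp z
        ((hψ.differentiable (by simp)) z).hasFDerivAt).hasFDerivWithinAt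
    · have hzx : dist x z ≤ dist x y := by rw [dist_comm x z]; exact hz.2
      calc ‖(fderiv ℝ f (ψ z)).comp (fderiv ℝ ψ z)‖
          ≤ ‖fderiv ℝ f (ψ z)‖ * ‖fderiv ℝ ψ z‖ := ContinuousLinearMap.opNorm_comp_le _ _
        _ ≤ (ε / max C 1 * dist x y ^ k) * max C 1 := by
            gcongr
            · exact (h x hx z hz.1 (hzx.trans_lt hxy)).trans (by gcongr)
            · exact (hC z hz.1).trans (le_max_left _ _)
        _ = ε * dist x y ^ k := by field_simp
  rw [← dist_eq_norm y x, dist_comm y x] at key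
  rwa [pow_succ, ← mul_assoc]

/-- `T` is contained in the image, under a `C^1` map `ψ` of a Euclidean space of dimension at most
`n`, of a bounded set `S` near which `f ∘ ψ` is little-o of the `k`-th power of the distance to `S`,
for all `C^k` functions `f` that vanish on `A`. -/
def IsFlatPiece (n k : ℕ) (A T : Set (EuclideanSpace ℝ (Fin n))) : Prop :=
  ∃ m ≤ n, ∃ ψ : EuclideanSpace ℝ (Fin m) → EuclideanSpace ℝ (Fin n), ContDiff ℝ 1 ψ ∧
    ∃ (R : ℝ) (S : Set (EuclideanSpace ℝ (Fin m))), S ⊆ closedBall 0 R ∧ T ⊆ ψ '' S ∧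
      MapsTo ψ S A ∧
      ∀ (F : Type) [NormedAddCommGroup F] [NormedSpace ℝ F] (f : EuclideanSpace ℝ (Fin n) → F),
        ContDiff ℝ k f → (∀ a ∈ A, f a = 0) → ∀ ε > 0, ∃ δ > 0, ∀ x ∈ S,
          ∀ y ∈ closedBall (0 : EuclideanSpace ℝ (Fin m)) R, dist x y < δ →
            ‖f (ψ y)‖ ≤ ε * dist x y ^ k

/-- `B` is covered by countably many flat pieces for `A`. -/
def IsFlatCovered (n k : ℕ) (A B : Set (EuclideanSpace ℝ (Fin n))) : Prop :=
  ∃ 𝒯 : Set (Set (EuclideanSpace ℝ (Fin n))), 𝒯.Countable ∧ B ⊆ ⋃₀ 𝒯 ∧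
    ∀ T ∈ 𝒯, IsFlatPiece n k A T

theorem IsFlatCovered.mono {n k : ℕ} {A B B' : Set (EuclideanSpace ℝ (Fin n))}
    (h : IsFlatCovered n k A B) (hB : B' ⊆ B) : IsFlatCovered n k A B' := by
  obtain ⟨𝒯, h1, h2, h3⟩ := h
  exact ⟨𝒯, h1, hB.trans h2, h3⟩

theorem isFlatCovered_iUnion {ι : Type*} [Countable ι] {n k : ℕ}
    {A : Set (EuclideanSpace ℝ (Fin n))} {B : ι → Set (EuclideanSpace ℝ (Fin n))}
    (h : ∀ i, IsFlatCovered n k A (B i)) : IsFlatCovered n k A (⋃ i, B i) := by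
  choose 𝒯 h1 h2 h3 using h
  refine ⟨⋃ i, 𝒯 i, countable_iUnion h1, iUnion_subset fun i => (h2 i).trans ?_, ?_⟩
  · exact sUnion_subset_sUnion (subset_iUnion _ _)
  · intro T hT
    obtain ⟨i, hi⟩ := mem_iUnion.1 hT
    exact h3 i T hi

theorem isFlatCovered_of_nhds {n k : ℕ} {A B : Set (EuclideanSpace ℝ (Fin n))}
    (h : ∀ x ∈ B, ∃ U ∈ 𝓝 x, IsFlatCovered n k A (B ∩ U)) : IsFlatCovered n k A B := by
  choose! U hU hB using h
  obtain ⟨t, htB, htc, ht⟩ := TopologicalSpace.countable_cover_nhdsWithin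
    (fun x hx => mem_nhdsWithin_of_mem_nhds (hU x hx))
  have := htc.to_subtype
  refine (isFlatCovered_iUnion fun i : t => hB i (htB i.2)).mono fun x hx => ?_
  obtain ⟨i, hi, hxi⟩ := mem_iUnion₂.1 (ht hx)
  exact mem_iUnion.2 ⟨⟨i, hi⟩, hx, hxi⟩

theorem isFlatCovered_zero (n : ℕ) (A : Set (EuclideanSpace ℝ (Fin n))) :
    IsFlatCovered n 0 A A := by
  refine ⟨range fun N : ℕ => A ∩ closedBall 0 N, countable_range _, fun x hx => ?_, ?_⟩
  · obtain ⟨N, hN⟩ := exists_nat_ge ‖x‖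
    exact mem_sUnion.2 ⟨_, ⟨N, rfl⟩, hx, by simpa using hN⟩
  · rintro _ ⟨N, rfl⟩
    refine ⟨n, le_rfl, id, contDiff_id, N, A ∩ closedBall 0 N, inter_subset_right, by simp,
      fun x hx => hx.1, fun F _ _ f hf hA ε hε => ?_⟩
    obtain ⟨δ, hδ, h⟩ := Metric.uniformContinuousOn_iff.1
      ((isCompact_closedBall (0 : EuclideanSpace ℝ (Fin n)) N).uniformContinuousOn_of_continuous
        hf.continuous.continuousOn) ε hε
    refine ⟨δ, hδ, fun x hx y hy hxy => ?_⟩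
    have := h x hx.2 y hy hxy
    rw [hA x hx.1, dist_zero_left] at this
    simpa using this.le

/-- Flatness of order `k` for the derivative integrates to order `k + 1` for the function. The
derivative lives in a space of linear maps, which is why flat pieces quantify over all targets `F`.
-/
theorem IsFlatPiece.succ {n k : ℕ} {A B T : Set (EuclideanSpace ℝ (Fin n))} (hBA : B ⊆ A)
    (hB : ∀ (F : Type) [NormedAddCommGroup F] [NormedSpace ℝ F]
      (f : EuclideanSpace ℝ (Fin n) → F), ContDiff ℝ (k + 1 : ℕ) f → (∀ a ∈ A, f a = 0) →
        ∀ b ∈ B, fderiv ℝ f b = 0)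
    (h : IsFlatPiece n k B T) : IsFlatPiece n (k + 1) A T := by
  obtain ⟨m, hm, ψ, hψ, R, S, hS, hT, hmaps, hflat⟩ := h
  refine ⟨m, hm, ψ, hψ, R, S, hS, hT, fun x hx => hBA (hmaps hx), fun F _ _ f hf hA ε hε => ?_⟩
  have hfd : ContDiff ℝ k (fderiv ℝ f) := hf.fderiv_right (by simp)
  obtain ⟨δ, hδ, h⟩ := norm_comp_sub_le_of_fderiv_flat hψ (hf.differentiable (by simp)) hS
    (hflat _ (fderiv ℝ f) hfd (hB F f hf hA)) ε hε
  refine ⟨δ, hδ, fun x hx y hy hxy => ?_⟩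
  simpa [hA _ (hBA (hmaps hx))] using h x hx y hy hxy

theorem IsFlatPiece.image {n k : ℕ} {A : Set (EuclideanSpace ℝ (Fin (n + 1)))}
    {T : Set (EuclideanSpace ℝ (Fin n))} (hk : k ≠ 0)
    {φ : EuclideanSpace ℝ (Fin n) → EuclideanSpace ℝ (Fin (n + 1))} (hφ : ContDiff ℝ k φ)
    (h : IsFlatPiece n k (φ ⁻¹' A) T) : IsFlatPiece (n + 1) k A (φ '' T) := by
  obtain ⟨m, hm, ψ, hψ, R, S, hS, hT, hmaps, hflat⟩ := h
  have h1 : ((1 : ℕ) : WithTop ℕ∞) ≤ k := by exact_mod_cast Nat.one_le_iff_ne_zero.2 hk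
  refine ⟨m, by omega, φ ∘ ψ, (hφ.of_le (by simpa using h1)).comp hψ, R, S, hS, ?_,
    fun x hx => hmaps hx, fun F _ _ f hf hA => ?_⟩
  · rw [image_comp]
    exact image_mono hT
  · exact hflat F (f ∘ φ) (hf.comp hφ) fun a ha => hA _ ha

/-- Near a point where the derivative of a function vanishing on `A` does not vanish, `A` is covered
by flat pieces coming from one dimension less. -/
theorem exists_nhds_isFlatCovered {n k : ℕ}
    (ih : ∀ A : Set (EuclideanSpace ℝ (Fin n)), IsFlatCovered n (k + 1) A A)
    {A : Set (EuclideanSpace ℝ (Fin (n + 1)))} {x : EuclideanSpace ℝ (Fin (n + 1))} (hx : x ∈ A)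
    {g : EuclideanSpace ℝ (Fin (n + 1)) → ℝ} (hg : ContDiff ℝ (k + 1 : ℕ) g)
    (hgA : ∀ a ∈ A, g a = 0) (hgx : fderiv ℝ g x ≠ 0) :
    ∃ U ∈ 𝓝 x, IsFlatCovered (n + 1) (k + 1) A (A ∩ U) := by
  have hsurj : Function.Surjective (fderiv ℝ g x) :=
    LinearMap.surjective (f := (fderiv ℝ g x).toLinearMap)
      (fun h => hgx (by ext v; exact DFunLike.congr_fun h v))
  obtain ⟨φ, hφ, -, hrange⟩ := exists_contDiff_parametrization (Nat.succ_ne_zero k)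
    hg.contDiffAt hsurj (r := n) (by simp) univ_mem
  refine ⟨_, hrange, ?_⟩
  obtain ⟨𝒯, h1, h2, h3⟩ := ih (φ ⁻¹' A)
  refine ⟨image φ '' 𝒯, h1.image _, ?_, ?_⟩
  · rintro y ⟨hyA, hy⟩
    obtain ⟨t, rfl⟩ := hy (by rw [hgA y hyA, hgA x hx])
    obtain ⟨T, hT, htT⟩ := h2 (show t ∈ φ ⁻¹' A from hyA)
    exact mem_sUnion.2 ⟨_, mem_image_of_mem _ hT, mem_image_of_mem _ htT⟩
  · rintro _ ⟨T, hT, rfl⟩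
    exact (h3 T hT).image (Nat.succ_ne_zero k) hφ

/-- Induction on `k`. Let `B` be the part of `A` where every `C^(k+1)` function vanishing on `A` has
zero derivative: order `k` pieces for `B` are order `k + 1` pieces for `A`. Near a point of `A \ B`,
`A` lies in a smooth hypersurface, and the dimension drops by one. -/
theorem isFlatCovered_self_of_pred {n : ℕ}
    (ih : ∀ m, n = m + 1 → ∀ k A, IsFlatCovered m k A A) (k : ℕ)
    (A : Set (EuclideanSpace ℝ (Fin n))) : IsFlatCovered n k A A := by
  induction k generalizing A with
  | zero => exact isFlatCovered_zero n A
  | succ k ihk =>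
    let B : Set (EuclideanSpace ℝ (Fin n)) := {x ∈ A | ∀ g : EuclideanSpace ℝ (Fin n) → ℝ,
      ContDiff ℝ (k + 1 : ℕ) g → (∀ a ∈ A, g a = 0) → fderiv ℝ g x = 0}
    have hBA : B ⊆ A := fun x hx => hx.1
    have hB : IsFlatCovered n (k + 1) A B := by
      obtain ⟨𝒯, h1, h2, h3⟩ := ihk B
      refine ⟨𝒯, h1, h2, fun T hT => (h3 T hT).succ hBA fun F _ _ f hf hA b hb => ?_⟩
      ext v
      -- `B` only tests real-valued functions; functionals reduce a general target to these.
      refine SeparatingDual.eq_zero_of_forall_dual_eq_zero (R := ℝ) fun ℓ => ?_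
      have h := hb.2 (ℓ ∘ f) (ℓ.contDiff.comp hf) (fun a ha => by simp [hA a ha])
      rw [fderiv_comp _ ℓ.differentiableAt (hf.differentiable (by simp) b), ℓ.fderiv] at h
      exact DFunLike.congr_fun h v
    have hAB : IsFlatCovered n (k + 1) A (A \ B) := by
      refine isFlatCovered_of_nhds fun x hx => ?_
      obtain ⟨g, hg, hgA, hgx⟩ : ∃ g : EuclideanSpace ℝ (Fin n) → ℝ,
          ContDiff ℝ (k + 1 : ℕ) g ∧ (∀ a ∈ A, g a = 0) ∧ fderiv ℝ g x ≠ 0 := by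
        by_contra! h
        exact hx.2 ⟨hx.1, h⟩
      rcases n with - | n
      · exact absurd (Subsingleton.elim _ _) hgx
      · obtain ⟨U, hU, h⟩ := exists_nhds_isFlatCovered (ih n rfl (k + 1)) hx.1 hg hgA hgx
        exact ⟨U, hU, h.mono (inter_subset_inter_left _ sdiff_subset)⟩
    refine (isFlatCovered_iUnion (B := fun b : Bool => if b then B else A \ B) ?_).mono ?_
    · rintro (_ | _)
      exacts [by simpa using hAB, by simpa using hB]
    · intro x hx
      by_cases hxB : x ∈ B
      exacts [mem_iUnion.2 ⟨true, by simpa using hxB⟩, mem_iUnion.2 ⟨false, by simp [hx, hxB]⟩]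

/-- **Morse's lemma**: every set is covered by countably many flat pieces. -/
theorem isFlatCovered_self (n k : ℕ) (A : Set (EuclideanSpace ℝ (Fin n))) :
    IsFlatCovered n k A A := by
  induction n generalizing k with
  | zero => exact isFlatCovered_self_of_pred (fun m hm => by omega) k A
  | succ n ihn =>
    refine isFlatCovered_self_of_pred (fun m hm => ?_) k A
    obtain rfl : n = m := by omega
    exact fun k A => ihn k A

/-! ### The Morse-Sard theorem -/

/-- A function on a bounded set of a Euclidean space of dimension `m ≤ p` whose increments are
little-o of the `p`-th power of the distance has a null image. -/
theorem volume_image_eq_zero_of_flat {m p : ℕ} (hmp : m ≤ p) {g : EuclideanSpace ℝ (Fin m) → ℝ}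
    {S : Set (EuclideanSpace ℝ (Fin m))} {R : ℝ} (hS : S ⊆ closedBall 0 R)
    (hg : ∀ ε > 0, ∃ δ > 0, ∀ x ∈ S, ∀ y ∈ S, dist x y < δ →
      dist (g x) (g y) ≤ ε * dist x y ^ p) : volume (g '' S) = 0 := by
  -- The Hausdorff measure estimate below needs a positive Hölder exponent.
  rcases Nat.eq_zero_or_pos m with rfl | hm
  · exact ((subsingleton_of_subsingleton (s := S)).image g).measure_zero _
  have hfin : μH[(m : ℝ)] (closedBall (0 : EuclideanSpace ℝ (Fin m)) R) ≠ ∞ := by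
    have h := isAddHaarMeasure_hausdorffMeasure (E := EuclideanSpace ℝ (Fin m))
    rw [finrank_euclideanSpace, Fintype.card_fin] at h
    exact (h.lt_top_of_isCompact (isCompact_closedBall _ _)).ne
  have key : ∀ ε : ℝ≥0, 0 < ε →
      volume (g '' S) ≤ ε * μH[(m : ℝ)] (closedBall (0 : EuclideanSpace ℝ (Fin m)) R) := by
    intro ε hε
    obtain ⟨δ, hδ, h⟩ := hg ε hε
    -- Distances below `1` satisfy `dist ^ p ≤ dist ^ m`, so `g` is `m`-Hölder with constant `ε` on
    -- each piece of diameter at most `η`.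
    let η := min δ 1
    have hη : 0 < η := lt_min hδ one_pos
    let D : ℕ → Set (EuclideanSpace ℝ (Fin m)) :=
      disjointed fun i => ball (TopologicalSpace.denseSeq (EuclideanSpace ℝ (Fin m)) i) (η / 2)
    have hDmeas : ∀ i, MeasurableSet (D i) :=
      fun i => MeasurableSet.disjointed (fun j => measurableSet_ball) i
    have hDuniv : ⋃ i, D i = univ := by
      rw [iUnion_disjointed]
      refine eq_univ_of_forall fun x => ?_
      obtain ⟨i, hi⟩ := (TopologicalSpace.denseRange_denseSeq _).exists_dist_lt x (half_pos hη)
      exact mem_iUnion.2 ⟨i, hi⟩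
    have hDdist : ∀ i, ∀ x ∈ D i, ∀ y ∈ D i, dist x y < η := fun i x hx y hy => by
      have h1 := disjointed_subset _ i hx
      have h2 := disjointed_subset _ i hy
      rw [mem_ball] at h1 h2
      linarith [dist_triangle_right x y
        (TopologicalSpace.denseSeq (EuclideanSpace ℝ (Fin m)) i)]
    have hpiece : ∀ i, volume (g '' (S ∩ D i)) ≤ ε * μH[(m : ℝ)] (closedBall 0 R ∩ D i) := by
      intro i
      have hold : HolderOnWith ε m g (S ∩ D i) := by
        intro x hx y hy
        have hd := hDdist i x hx.2 y hy.2
        have h1 : dist (g x) (g y) ≤ ε * dist x y ^ m :=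
          (h x hx.1 y hy.1 (hd.trans_le (min_le_left _ _))).trans (by
            gcongr ?_ * ?_
            exact pow_le_pow_of_le_one dist_nonneg (hd.le.trans (min_le_right _ _)) hmp)
        rw [edist_dist, edist_dist]
        simp only [NNReal.coe_natCast, ENNReal.rpow_natCast]
        rw [← ENNReal.ofReal_pow dist_nonneg, ← ENNReal.ofReal_coe_nnreal,
          ← ENNReal.ofReal_mul ε.coe_nonneg]
        exact ENNReal.ofReal_le_ofReal h1
      have h2 := hold.hausdorffMeasure_image_le (by exact_mod_cast hm) zero_le_one
      rw [hausdorffMeasure_real] at h2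
      simp only [ENNReal.rpow_one, NNReal.coe_natCast, mul_one] at h2
      exact h2.trans (by gcongr)
    calc volume (g '' S) ≤ volume (⋃ i, g '' (S ∩ D i)) := by
          rw [← image_iUnion, ← inter_iUnion, hDuniv, inter_univ]
      _ ≤ ∑' i, volume (g '' (S ∩ D i)) := measure_iUnion_le _
      _ ≤ ∑' i, ε * μH[(m : ℝ)] (closedBall 0 R ∩ D i) := ENNReal.tsum_le_tsum hpiece
      _ = ε * μH[(m : ℝ)] (closedBall (0 : EuclideanSpace ℝ (Fin m)) R) := by
          rw [ENNReal.tsum_mul_left, ← measure_iUnion, ← inter_iUnion, hDuniv, inter_univ]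
          · exact fun i j hij => ((disjoint_disjointed _ hij).mono inter_subset_right
              inter_subset_right)
          · exact fun i => measurableSet_closedBall.inter (hDmeas i)
  refine le_antisymm (ENNReal.le_of_forall_pos_le_add fun ε hε _ => ?_) zero_le
  obtain ⟨ε', hε', h⟩ := ENNReal.exists_nnreal_pos_mul_lt hfin
    (ENNReal.coe_ne_zero.2 hε.ne')
  rw [zero_add]
  exact (key ε' hε').trans h.le

/-- The **Morse-Sard theorem** for real-valued functions. -/
theorem volume_image_setOf_fderiv_eq_zero {r k : ℕ} (hrk : r ≤ k + 1)
    {f : EuclideanSpace ℝ (Fin r) → ℝ} (hf : ContDiff ℝ (k + 1 : ℕ) f) :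
    volume (f '' {x | fderiv ℝ f x = 0}) = 0 := by
  obtain ⟨𝒯, h1, h2, h3⟩ := isFlatCovered_self r k {x | fderiv ℝ f x = 0}
  refine measure_mono_null (image_mono h2) ?_
  rw [sUnion_eq_biUnion, image_iUnion₂, measure_biUnion_null_iff h1]
  intro T hT
  obtain ⟨m, hm, ψ, hψ, R, S, hS, hTS, -, hflat⟩ := h3 T hT
  refine measure_mono_null (image_mono hTS) ?_
  rw [← image_comp]
  refine volume_image_eq_zero_of_flat (hm.trans hrk) hS fun ε hε => ?_
  obtain ⟨δ, hδ, h⟩ := norm_comp_sub_le_of_fderiv_flat hψ (hf.differentiable (by simp)) hS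
    (hflat _ (fderiv ℝ f) (hf.fderiv_right (by simp)) fun a ha => ha) ε hε
  refine ⟨δ, hδ, fun x hx y hy hxy => ?_⟩
  rw [dist_comm, dist_eq_norm]
  exact h x hx y (hS hy) hxy

/-! ### Tangent spaces and critical values on manifolds -/

section Strata

variable {E : Type*} [NormedAddCommGroup E] [InnerProductSpace ℝ E]

theorem IsLocalDefiningMap.apply_eq_zero {p : WithTop ℕ∞} {M U : Set E} {x y : E} {m : ℕ}
    {F : E → EuclideanSpace ℝ (Fin m)} (h : IsLocalDefiningMap p M x U F) (hy : y ∈ M)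
    (hyU : y ∈ U) : F y = 0 :=
  (h.inter_eq.subset ⟨hy, hyU⟩).2

theorem IsLocalDefiningMap.mem_of_apply_eq_zero {p : WithTop ℕ∞} {M U : Set E} {x y : E} {m : ℕ}
    {F : E → EuclideanSpace ℝ (Fin m)} (h : IsLocalDefiningMap p M x U F) (hyU : y ∈ U)
    (hy : F y = 0) : y ∈ M :=
  (h.inter_eq.superset ⟨hyU, hy⟩).1

theorem IsLocalDefiningMap.contDiffAt {p : WithTop ℕ∞} {M U : Set E} {x : E} {m : ℕ}
    {F : E → EuclideanSpace ℝ (Fin m)} (h : IsLocalDefiningMap p M x U F) : ContDiffAt ℝ p F x :=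
  h.contDiffOn.contDiffAt (h.isOpen.mem_nhds h.mem)

/-- The derivative of a map into a manifold takes values in the tangent space. -/
theorem IsCpManifold.fderiv_mem_tangentSpaceAt {G : Type*} [NormedAddCommGroup G]
    [NormedSpace ℝ G] {p : WithTop ℕ∞} (hp : p ≠ 0) {M : Set E} (hM : IsCpManifold p M)
    {φ : G → E} (hφ : ∀ t, φ t ∈ M) {t : G} (hd : DifferentiableAt ℝ φ t) (w : G) :
    fderiv ℝ φ t w ∈ tangentSpaceAt p M (φ t) := by
  obtain ⟨r, m, -, hloc⟩ := hM
  obtain ⟨U, F, hF⟩ := hloc _ (hφ t)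
  refine Submodule.subset_span ⟨m, U, F, hF, ?_⟩
  have hzero : F ∘ φ =ᶠ[𝓝 t] fun _ => 0 := by
    filter_upwards [hd.continuousAt.eventually_mem (hF.isOpen.mem_nhds hF.mem)] with s hs
    exact hF.apply_eq_zero (hφ s) hs
  have h1 := (hF.contDiffAt.differentiableAt hp).hasFDerivAt.comp t hd.hasFDerivAt
  have h2 : HasFDerivAt (F ∘ φ) (0 : G →L[ℝ] EuclideanSpace ℝ (Fin m)) t :=
    (hasFDerivAt_const _ t).congr_of_eventuallyEq hzero
  exact DFunLike.congr_fun (h1.unique h2) w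

/-- Every vector in the kernel of the derivative of a local defining map is the velocity of a curve
in the manifold. -/
theorem IsLocalDefiningMap.exists_hasDerivAt [CompleteSpace E] {p : WithTop ℕ∞} (hp : p ≠ 0)
    {M U : Set E} {x : E} {m : ℕ} {F : E → EuclideanSpace ℝ (Fin m)}
    (hF : IsLocalDefiningMap p M x U F) (hx : x ∈ M) {w : E} (hw : fderiv ℝ F x w = 0) :
    ∃ γ : ℝ → E, HasDerivAt γ w 0 ∧ γ 0 = x ∧ ∀ᶠ t in 𝓝 0, γ t ∈ M := by
  have hs := hF.contDiffAt.hasStrictFDerivAt hp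
  have hr : (fderiv ℝ F x).range = ⊤ := LinearMap.range_eq_top.2 hF.surjective
  let ψ := hs.implicitFunction F (fderiv ℝ F x) hr (F x)
  have hψ : HasFDerivAt ψ (fderiv ℝ F x).ker.subtypeL 0 := (hs.to_implicitFunction hr).hasFDerivAt
  have hψ0 : ψ 0 = x := hs.implicitFunction_apply_image hr
  let w' : (fderiv ℝ F x).ker := ⟨w, hw⟩
  have hline : HasDerivAt (fun t : ℝ => t • w') w' 0 := by
    simpa using (hasDerivAt_id (0 : ℝ)).smul_const w'
  have hψ' : HasFDerivAt ψ (fderiv ℝ F x).ker.subtypeL ((0 : ℝ) • w') := by rwa [zero_smul]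
  have hγ : HasDerivAt (fun t : ℝ => ψ (t • w')) w 0 := by
    have h := hψ'.comp_hasDerivAt (0 : ℝ) hline
    exact h
  refine ⟨fun t => ψ (t • w'), hγ, by simp [hψ0], ?_⟩
  have hFγ : ∀ᶠ t in 𝓝 (0 : ℝ), F (ψ (t • w')) = F x := by
    have ht : Tendsto (fun t : ℝ => (F x, t • w')) (𝓝 0) (𝓝 (F x, 0)) :=
      tendsto_const_nhds.prodMk_nhds (by simpa using hline.continuousAt.tendsto)
    exact ht.eventually (hs.map_implicitFunction_eq hr)
  have hγU : ∀ᶠ t in 𝓝 (0 : ℝ), ψ (t • w') ∈ U := hγ.continuousAt.eventually_mem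
    (by rw [zero_smul, hψ0]; exact hF.isOpen.mem_nhds hF.mem)
  filter_upwards [hFγ, hγU] with t h1 h2
  exact hF.mem_of_apply_eq_zero h2 (h1.trans (hF.apply_eq_zero hx hF.mem))

theorem IsCpManifold.exists_parametrization [FiniteDimensional ℝ E] {p : ℕ} (hp : p ≠ 0)
    {M : Set E} (hM : IsCpManifold p M) : ∃ r m : ℕ, r + m = Module.finrank ℝ E ∧
      (m = 0 → IsOpen M) ∧
      ∀ x ∈ M, ∃ φ : EuclideanSpace ℝ (Fin r) → E, ContDiff ℝ p φ ∧ (∀ t, φ t ∈ M) ∧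
        ∀ᶠ y in 𝓝 x, y ∈ M → y ∈ range φ := by
  obtain ⟨r, m, hrm, hloc⟩ := hM
  refine ⟨r, m, hrm, ?_, fun x hx => ?_⟩
  · rintro rfl
    refine isOpen_iff_mem_nhds.2 fun x hx => ?_
    obtain ⟨U, F, hF⟩ := hloc x hx
    exact mem_of_superset (hF.isOpen.mem_nhds hF.mem) fun y hy =>
      hF.mem_of_apply_eq_zero hy (Subsingleton.elim _ _)
  · obtain ⟨U, F, hF⟩ := hloc x hx
    have hU := hF.isOpen.mem_nhds hF.mem
    have hFx := hF.apply_eq_zero hx hF.mem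
    obtain ⟨φ, hφ, hφM, hrange⟩ := exists_contDiff_parametrization hp hF.contDiffAt hF.surjective
      (r := r) (by simpa using hrm) hU
    refine ⟨φ, hφ, fun t => hF.mem_of_apply_eq_zero (hφM t).1 ((hφM t).2.trans hFx), ?_⟩
    filter_upwards [hrange, hU] with y hy hyU hyM
    exact hy ((hF.apply_eq_zero hyM hyU).trans hFx.symm)

/-- A linear functional restricted to a `C^p` manifold of dimension at most `p` has a null set of
critical values. -/
theorem IsCpManifold.volume_image_setOf_tangent_le_ker [FiniteDimensional ℝ E] {p : ℕ} (hp : p ≠ 0)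
    {M : Set E} (hM : IsCpManifold p M) (hdim : Module.finrank ℝ E ≤ p + 1)
    (hopen : ¬ IsOpen M) (ℓ : E →L[ℝ] ℝ) :
    volume (ℓ '' {z ∈ M | ∀ w ∈ tangentSpaceAt p M z, ℓ w = 0}) = 0 := by
  obtain ⟨r, m, hrm, hm, hloc⟩ := hM.exists_parametrization hp
  -- Codimension zero would make `M` open, so the dimension is at most `p`, as Morse-Sard requires.
  have hrp : r ≤ p := by
    have : m ≠ 0 := fun h => hopen (hm h)
    omega
  choose! φ hφ hφM hrange using hloc
  obtain ⟨t, htM, htc, ht⟩ := TopologicalSpace.countable_cover_nhdsWithin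
    (fun x hx => mem_nhdsWithin_of_mem_nhds (hrange x hx))
  obtain ⟨k, rfl⟩ := Nat.exists_eq_succ_of_ne_zero hp
  refine measure_mono_null (t := ⋃ x ∈ t, (ℓ ∘ φ x) '' {s | fderiv ℝ (ℓ ∘ φ x) s = 0}) ?_
    ((measure_biUnion_null_iff htc).2 fun x hx => volume_image_setOf_fderiv_eq_zero hrp
      (ℓ.contDiff.comp (hφ x (htM hx))))
  rintro _ ⟨z, ⟨hzM, hz⟩, rfl⟩
  obtain ⟨x, hx, hzx⟩ := mem_iUnion₂.1 (ht hzM)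
  obtain ⟨s, rfl⟩ := hzx hzM
  refine mem_iUnion₂.2 ⟨x, hx, s, ?_, rfl⟩
  have hd : DifferentiableAt ℝ (φ x) s := (hφ x (htM hx)).differentiable (by simp) s
  ext w
  rw [fderiv_comp _ ℓ.differentiableAt hd, ℓ.fderiv]
  exact hz _ (hM.fderiv_mem_tangentSpaceAt (by simp) (hφM x (htM hx)) hd w)

end Strata

/-! ### Strata of the graph and Clarke subgradients -/

section Graph

variable {d : ℕ}

/-- Differentiate the identity between `f` of the first coordinate and the second coordinate along a
curve in `M` with the given velocity. The conclusion is linear, so it passes to the span. -/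
theorem snd_eq_fderiv_of_mem_tangentSpaceAt {f : EuclideanSpace ℝ (Fin d) → ℝ} {p : WithTop ℕ∞}
    (hp : p ≠ 0) {M : Set (WithLp 2 (EuclideanSpace ℝ (Fin d) × ℝ))} (hM : M ⊆ euclideanGraph f)
    {z : WithLp 2 (EuclideanSpace ℝ (Fin d) × ℝ)} (hz : z ∈ M) (hf : DifferentiableAt ℝ f z.fst)
    {w : WithLp 2 (EuclideanSpace ℝ (Fin d) × ℝ)} (hw : w ∈ tangentSpaceAt p M z) :
    w.snd = fderiv ℝ f z.fst w.fst := by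
  let pr₁ := WithLp.fstL 2 ℝ (EuclideanSpace ℝ (Fin d)) ℝ
  let pr₂ := WithLp.sndL 2 ℝ (EuclideanSpace ℝ (Fin d)) ℝ
  suffices h : tangentSpaceAt p M z ≤ (pr₂ - (fderiv ℝ f z.fst).comp pr₁).ker by
    exact sub_eq_zero.1 (h hw)
  refine Submodule.span_le.2 ?_
  rintro w ⟨m, U, F, hF, hw⟩
  obtain ⟨γ, hγ, hγ0, hγM⟩ := hF.exists_hasDerivAt hp hz hw
  have heq : (fun t => f (pr₁ (γ t))) =ᶠ[𝓝 0] fun t => pr₂ (γ t) := by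
    filter_upwards [hγM] with t ht
    exact hM ht
  have hfd : HasFDerivAt f (fderiv ℝ f z.fst) (pr₁ (γ 0)) := by
    rw [hγ0]; exact hf.hasFDerivAt
  have h1 := hfd.comp_hasDerivAt 0 (pr₁.hasFDerivAt.comp_hasDerivAt 0 hγ)
  have h2 := (pr₂.hasFDerivAt.comp_hasDerivAt 0 hγ).congr_of_eventuallyEq heq
  exact sub_eq_zero.2 (h2.unique h1)

theorem mem_normalSpaceAt_of_differentiableAt {f : EuclideanSpace ℝ (Fin d) → ℝ} {p : WithTop ℕ∞}
    (hp : p ≠ 0) {M : Set (WithLp 2 (EuclideanSpace ℝ (Fin d) × ℝ))} (hM : M ⊆ euclideanGraph f)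
    {z : WithLp 2 (EuclideanSpace ℝ (Fin d) × ℝ)} (hz : z ∈ M) (hf : DifferentiableAt ℝ f z.fst) :
    WithLp.toLp 2 (-gradient f z.fst, (1 : ℝ)) ∈ normalSpaceAt p M z := by
  refine (Submodule.mem_orthogonal' _ _).2 fun w hw => ?_
  have h := snd_eq_fderiv_of_mem_tangentSpaceAt hp hM hz hf hw
  have h2 : inner ℝ (gradient f z.fst) w.fst = fderiv ℝ f z.fst w.fst :=
    InnerProductSpace.toDual_symm_apply
  simp [WithLp.prod_inner_apply, h2, h]

/-- Clarke subgradients give normal vectors to the strata of the graph. -/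
theorem mem_normalSpaceAt_of_mem_clarkeSubdifferential {f : EuclideanSpace ℝ (Fin d) → ℝ}
    (hf : Continuous f) {p : WithTop ℕ∞} (hp : p ≠ 0)
    {𝒜 : Set (Set (WithLp 2 (EuclideanSpace ℝ (Fin d) × ℝ)))}
    (h𝒜 : IsWhitneyStratification p 𝒜 (euclideanGraph f))
    {L : Set (WithLp 2 (EuclideanSpace ℝ (Fin d) × ℝ))} (hL : L ∈ 𝒜)
    {x v : EuclideanSpace ℝ (Fin d)} (hx : WithLp.toLp 2 (x, f x) ∈ L)
    (hv : v ∈ clarkeSubdifferential f x) :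
    WithLp.toLp 2 (-v, (1 : ℝ)) ∈ normalSpaceAt p L (WithLp.toLp 2 (x, f x)) := by
  let N := normalSpaceAt p L (WithLp.toLp 2 (x, f x))
  -- The last coordinate stays `1` under convex combinations: this set is an affine slice of `N`, up
  -- to sign.
  have hconv : Convex ℝ {v : EuclideanSpace ℝ (Fin d) | WithLp.toLp 2 (-v, (1 : ℝ)) ∈ N} := by
    intro v hv w hw a b _ _ hab
    have h : WithLp.toLp 2 (-(a • v + b • w), (1 : ℝ)) =
        a • WithLp.toLp 2 (-v, (1 : ℝ)) + b • WithLp.toLp 2 (-w, (1 : ℝ)) := by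
      refine WithLp.ofLp_injective 2 (Prod.ext ?_ ?_)
      · change -(a • v + b • w) = a • -v + b • -w
        module
      · change (1 : ℝ) = a * 1 + b * 1
        rw [mul_one, mul_one, hab]
    rw [mem_ofPred_eq, h]
    exact N.add_mem (N.smul_mem a hv) (N.smul_mem b hw)
  refine convexHull_min ?_ hconv hv
  rintro v ⟨u, hu, hux, hgrad⟩
  have hmem : ∀ i, ∃ M ∈ 𝒜, WithLp.toLp 2 (u i, f (u i)) ∈ M := fun i => by
    have h : WithLp.toLp 2 (u i, f (u i)) ∈ ⋃₀ 𝒜 := h𝒜.sUnion_eq ▸ rfl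
    exact h
  choose M hM𝒜 hM using hmem
  have := h𝒜.finite.to_subtype
  -- Condition (a) needs a sequence in a single stratum; by finiteness, one stratum is visited
  -- infinitely often.
  obtain ⟨⟨K, hK⟩, hfreq⟩ : ∃ K : 𝒜, ∃ᶠ i in atTop, (⟨M i, hM𝒜 i⟩ : 𝒜) = K := by
    by_contra! h
    obtain ⟨i, hi⟩ := (eventually_all.2 h).exists
    exact hi _ rfl
  obtain ⟨ns, hns, hnsK⟩ := extraction_of_frequently_atTop hfreq
  have hMK : ∀ j, M (ns j) = K := fun j => congrArg Subtype.val (hnsK j)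
  have hlift : Continuous fun q : EuclideanSpace ℝ (Fin d) × ℝ => WithLp.toLp 2 q :=
    WithLp.prod_continuous_toLp 2 _ _
  refine h𝒜.whitney_condition_a L hL K hK
    (fun j => WithLp.toLp 2 (u (ns j), f (u (ns j))))
    (fun j => WithLp.toLp 2 (-gradient f (u (ns j)), (1 : ℝ))) _ _ (fun j => hMK j ▸ hM _) hx
    ?_ (fun j => ?_) ?_
  · have h := hux.comp hns.tendsto_atTop
    exact (hlift.tendsto _).comp (h.prodMk_nhds ((hf.tendsto x).comp h))
  · exact mem_normalSpaceAt_of_differentiableAt hp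
      ((subset_sUnion_of_mem hK).trans h𝒜.sUnion_eq.subset)
      (z := WithLp.toLp 2 (u (ns j), f (u (ns j)))) (hMK j ▸ hM _) (hu _)
  · exact (hlift.tendsto _).comp
      ((hgrad.comp hns.tendsto_atTop).neg.prodMk_nhds tendsto_const_nhds)

/-- An open set contains a vertical segment and a graph does not. This excludes strata of dimension
`d + 1`. -/
theorem not_isOpen_of_subset_euclideanGraph {f : EuclideanSpace ℝ (Fin d) → ℝ}
    {M : Set (WithLp 2 (EuclideanSpace ℝ (Fin d) × ℝ))} (hM : M ⊆ euclideanGraph f)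
    (hne : M.Nonempty) : ¬ IsOpen M := by
  intro hopen
  obtain ⟨z, hz⟩ := hne
  have hc : Continuous fun t : ℝ => WithLp.toLp 2 (z.fst, z.snd + t) :=
    (WithLp.prod_continuous_toLp 2 _ _).comp (by fun_prop)
  have h : ∀ᶠ t in 𝓝 (0 : ℝ), WithLp.toLp 2 (z.fst, z.snd + t) ∈ M :=
    hc.continuousAt.eventually_mem (hopen.mem_nhds (by rw [add_zero]; exact hz))
  obtain ⟨δ, hδ, hball⟩ := Metric.eventually_nhds_iff_ball.1 h
  have h1 : f z.fst = z.snd + δ / 2 := hM (hball (δ / 2) (by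
    rw [mem_ball_zero_iff, Real.norm_of_nonneg (by positivity)]; linarith))
  have h2 : f z.fst = z.snd := hM hz
  linarith

theorem volume_clarkeCriticalValues_eq_zero {f : EuclideanSpace ℝ (Fin d) → ℝ} (hf : Continuous f)
    (hstrat : IsWhitneyStratifiable (d : WithTop ℕ∞) f) :
    volume (clarkeCriticalValues f) = 0 := by
  -- For `d = 0` the strata are only `C^0`, but the domain is a single point.
  rcases eq_or_ne d 0 with rfl | hd
  · refine Set.Subsingleton.measure_zero ?_ _
    rintro _ ⟨x, -, rfl⟩ _ ⟨y, -, rfl⟩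
    rw [Subsingleton.elim x y]
  obtain ⟨𝒜, h𝒜⟩ := hstrat
  have hd' : (d : WithTop ℕ∞) ≠ 0 := by exact_mod_cast hd
  let ℓ := WithLp.sndL 2 ℝ (EuclideanSpace ℝ (Fin d)) ℝ
  have hdim : Module.finrank ℝ (WithLp 2 (EuclideanSpace ℝ (Fin d) × ℝ)) ≤ d + 1 := by
    rw [(WithLp.linearEquiv 2 ℝ (EuclideanSpace ℝ (Fin d) × ℝ)).finrank_eq]
    simp
  refine measure_mono_null (t := ⋃ M ∈ 𝒜, ℓ '' {z ∈ M | ∀ w ∈ tangentSpaceAt d M z, ℓ w = 0}) ?_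
    ((measure_biUnion_null_iff h𝒜.finite.countable).2 fun M hM =>
      (h𝒜.isCpManifold M hM).volume_image_setOf_tangent_le_ker hd hdim
        (not_isOpen_of_subset_euclideanGraph
          ((subset_sUnion_of_mem hM).trans h𝒜.sUnion_eq.subset) (h𝒜.nonempty M hM)) ℓ)
  rintro _ ⟨x, hx, rfl⟩
  have h : WithLp.toLp 2 (x, f x) ∈ ⋃₀ 𝒜 := h𝒜.sUnion_eq ▸ rfl
  obtain ⟨L, hL, hxL⟩ := h
  refine mem_iUnion₂.2 ⟨L, hL, _, ⟨hxL, fun w hw => ?_⟩, rfl⟩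
  have hN := mem_normalSpaceAt_of_mem_clarkeSubdifferential hf hd' h𝒜 hL hxL hx
  have h := (Submodule.mem_orthogonal' _ _).1 hN w hw
  have hinner : inner ℝ (WithLp.toLp 2 (-(0 : EuclideanSpace ℝ (Fin d)), (1 : ℝ))) w = w.snd := by
    simp [WithLp.prod_inner_apply]
  exact hinner.symm.trans h

end Graph

theorem mainTheorem5 (d : ℕ) (f : EuclideanSpace ℝ (Fin d) → ℝ) (hf : LocallyLipschitz f)
    (hstrat : IsWhitneyStratifiable (d : WithTop ℕ∞) f) :
    volume (clarkeCriticalValues f) = 0 ∧ Dense (clarkeCriticalValues f)ᶜ := by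
  have h := volume_clarkeCriticalValues_eq_zero hf.continuous hstrat
  exact ⟨h, interior_eq_empty_iff_dense_compl.1 (Measure.interior_eq_empty_of_null h)⟩
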